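/- Let $\mathcal M$ be the set of bounded, non-decreasing, right-continuous functions on $[0,1]$. Let $m_0:[0,1]\to\mathbb R$ be non-decreasing and bounded, let $X_1,X_2,\dots$ be i.i.d. with distribution function $F_0$ and $0\le X_i\le 1$ almost surely, and let $Y_1,Y_2,\dots$ be i.i.d., independent of the sequence $(X_i)_i$, such that each $Y_i$ has the law of $m_0(X)+\epsilon$, where $X\sim F_0$ and $\epsilon$ is independent of $X$, has distribution function $\Phi_\epsilon$, finite first moment and $E(\epsilon)=0$. Assume that $\Phi_\epsilon$ is absolutely continuous with an even density $f_\epsilon$, put $\phi(t)=\int_{\mathbb R} e^{itx}f_\epsilon(x)\,dx$, and assume (A4) (ordinary smooth noise) for some $\beta>0$ and $d_0,d_1>0$, $\ d_0|t|^{-\beta}\le|\phi(t)|\le d_1|t|^{-\beta}$ for all sufficiently large $|t|$; (A5) there is $T^*$ such that $|\phi(t)|\ge|\phi(T)|>0$ for all $T>T^*$ and $|t|\le T$. For $n\ge1$ let $\mathbb H_n(y)=n^{-1}\sum_{i=1}^n \mathbf 1_{\{Y_i\le y\}}$, and let $\widehat m_n$ be any minimizer over $m\in\mathcal M$ of $$\mathbb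 M_n(m)=\int_{\mathbb R}\Big\{\mathbb H_n(y)-\frac1n\sum_{i=1}^n\Phi_\epsilon(y-m(X_i))\Big\}^2dy ,$$ chosen such that the $\widehat m_n(X_i)$, $1\le i\le n$, are random variables. Let $$\widehat{\mathbb L}_n(w)=\frac1n\sum_{i=1}^n\mathbf 1_{\{\widehat m_n(X_i)\le w\}},\qquad \mathbb L_n(w)=\frac1n\sum_{i=1}^n\mathbf 1_{\{m_0(X_i)\le w\}},\qquad w\in\mathbb R .$$ Then the expectation below is finite for every $n$, and, as $n\to\infty$, $$E\left[\int_{\mathbb R}\big(\widehat{\mathbb L}_n(w)-\mathbb L_n(w)\big)^2dw\right]=O\big(n^{-1/(2\beta+1)}\big).$$ -/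

import Mathlib

open MeasureTheory ProbabilityTheory Filter Set Asymptotics

noncomputable section

/-- The class `𝓜` of bounded, non-decreasing, right-continuous functions on `[0,1]`. Such a function
is represented by a function on `ℝ` of which only the values on `[0,1]` matter. -/
def monotoneClass : Set (ℝ → ℝ) :=
  {m | (∃ K : ℝ, ∀ x ∈ Icc (0 : ℝ) 1, |m x| ≤ K) ∧ MonotoneOn m (Icc 0 1) ∧
    ∀ x ∈ Icc (0 : ℝ) 1, ContinuousWithinAt m (Ici x ∩ Icc 0 1) x}

/-- The empirical distribution function of the sample `x 0, …, x (n - 1)`. -/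
def empiricalCDF (n : ℕ) (x : ℕ → ℝ) (w : ℝ) : ℝ :=
  (n : ℝ)⁻¹ * ∑ i ∈ Finset.range n, (Ici (x i)).indicator (fun _ => (1 : ℝ)) w

/-- The contrast `∫ (F₁ - F₂)²` between two distribution functions. -/
def contrast (F₁ F₂ : ℝ → ℝ) : ℝ := ∫ y, (F₁ y - F₂ y) ^ 2

/-- The criterion `𝕄ₙ(m) = ∫ (ℍₙ(y) - n⁻¹ ∑ᵢ Φ(y - m(xᵢ)))² dy`, with `ℍₙ` the empirical distribution
function of the responses `y 0, …, y (n - 1)` and `Φ` the distribution function of the noise. -/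
def criterion (Φ : ℝ → ℝ) (n : ℕ) (x y : ℕ → ℝ) (m : ℝ → ℝ) : ℝ :=
  contrast (empiricalCDF n y) (fun z => (n : ℝ)⁻¹ * ∑ i ∈ Finset.range n, Φ (z - m (x i)))

/-- `m` is a minimum contrast estimator for the data `x 0, …, x (n - 1)`, `y 0, …, y (n - 1)`. -/
def IsMinContrast (Φ : ℝ → ℝ) (n : ℕ) (x y : ℕ → ℝ) (m : ℝ → ℝ) : Prop :=
  m ∈ monotoneClass ∧ ∀ m' ∈ monotoneClass, criterion Φ n x y m ≤ criterion Φ n x y m'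

/-- The Fourier transform `φ_g(t) = ∫ e^{itx} g(x) dx`. -/
def fourierPhi (g : ℝ → ℝ) (t : ℝ) : ℂ :=
  ∫ x : ℝ, Complex.exp (Complex.I * (t : ℂ) * (x : ℂ)) * (g x : ℂ)

/-- `f` is a probability density, with respect to Lebesgue measure, of the law `ν` on `ℝ`. -/
def IsDensityOf (f : ℝ → ℝ) (ν : Measure ℝ) : Prop :=
  Measurable f ∧ (∀ x, 0 ≤ f x) ∧ ν = volume.withDensity (fun x => ENNReal.ofReal (f x))

/-- `f` is ordinary smooth of order `β`: for some `d₀, d₁ > 0`,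
`d₀ / |t| ^ β ≤ |φ_f(t)| ≤ d₁ / |t| ^ β` as soon as `|t|` is large. -/
def OrdinarySmooth (f : ℝ → ℝ) (β : ℝ) : Prop :=
  ∃ d₀ d₁ R : ℝ, 0 < d₀ ∧ 0 < d₁ ∧ 0 < R ∧ ∀ t : ℝ, R ≤ |t| →
    d₀ / |t| ^ β ≤ ‖fourierPhi f t‖ ∧ ‖fourierPhi f t‖ ≤ d₁ / |t| ^ β

/-- There is `T₀` with `|φ_f(t)| ≥ |φ_f(T)| > 0` for all `T > T₀` and `|t| ≤ T`. -/
def EventuallyMinimalFourier (f : ℝ → ℝ) : Prop :=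
  ∃ T₀ : ℝ, ∀ T > T₀, ∀ t : ℝ, |t| ≤ T →
    ‖fourierPhi f T‖ ≤ ‖fourierPhi f t‖ ∧ 0 < ‖fourierPhi f T‖

/-- The squared difference at `w` between the empirical distribution functions of
`m (x 0), …, m (x (n - 1))` and of `m₀ (x 0), …, m₀ (x (n - 1))`. -/
def sqDiffL (m m₀ : ℝ → ℝ) (n : ℕ) (x : ℕ → ℝ) (w : ℝ) : ℝ :=
  (empiricalCDF n (fun i => m (x i)) w - empiricalCDF n (fun i => m₀ (x i)) w) ^ 2

end

open scoped FourierTransform Convolution ComplexConjugate ENNReal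

/-! The loss is the squared L² distance between the empirical distribution functions of the
`mhat(X_i)` and of the `m₀(X_i)`. The contrast only sees these after convolution with the noise law,
so the proof bounds the smoothed distance and then deconvolves.

Smoothed distance: comparing the criterion at the minimizer and at `m₀` bounds it by `4 ∫ (ℍₙ -
S)²`, where `S` is the smoothed distribution function of the `m₀(X_i)`
(`IsMinContrast.integral_smoothedCDF_sub_sq_le`). At each point, `ℍₙ` and `S` are averages of i.i.d.
`[0,1]`-valued variables with the same mean, so their mean squared difference is a variance of order
`1/n`; first moments make it integrable over the line
(`lintegral_lintegral_empiricalCDF_sub_smoothedCDF_le`).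

Deconvolution (`IsDensityOf.exists_integral_empiricalCDF_sub_sq_le`): by Plancherel, smoothing is
multiplication by `φ`. Up to frequency `T` one has `|φ| ≥ d₀ T^(-β)`, so inverting costs `T^(2β)`.
Beyond `T`, the transform of a difference of empirical distribution functions is at most `1/(π|ξ|)`,
whatever the points, which contributes `O(1/T)`. The total `T^(2β)/n + 1/T` is balanced at `T =
n^(1/(2β+1))`. -/

/-! ### Plancherel's identity -/

/-- The Fourier transform of a reflected real function is the conjugate of its Fourier transform. -/
lemma fourier_ofReal_comp_neg (g : ℝ → ℝ) (ξ : ℝ) :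
    𝓕 (fun x => ((g (-x) : ℝ) : ℂ)) ξ = conj (𝓕 (fun x => ((g x : ℝ) : ℂ)) ξ) := by
  rw [Real.fourier_real_eq, Real.fourier_real_eq, ← integral_conj,
    ← integral_neg_eq_self]
  refine integral_congr_ae (Eventually.of_forall fun x => ?_)
  simp [Circle.smul_def, Real.fourierChar_apply, ← Complex.exp_conj, Complex.conj_ofNat]

/-- Plancherel's identity for bounded, integrable, almost everywhere continuous real functions whose
Fourier transform is square integrable. -/
lemma integral_sq_eq_integral_norm_fourier_sq {g : ℝ → ℝ} (hg : Integrable g) {C : ℝ}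
    (hC : ∀ x, |g x| ≤ C) (hcont : ∀ᵐ x, ContinuousAt g x)
    (hF : Integrable (fun ξ => ‖𝓕 (fun x => ((g x : ℝ) : ℂ)) ξ‖ ^ 2)) :
    ∫ x, g x ^ 2 = ∫ ξ, ‖𝓕 (fun x => ((g x : ℝ) : ℂ)) ξ‖ ^ 2 := by
  set gc : ℝ → ℂ := fun x => ((g x : ℝ) : ℂ) with hgc
  set gr : ℝ → ℂ := fun x => ((g (-x) : ℝ) : ℂ) with hgr
  have hgci : Integrable gc := hg.ofReal
  have hgri : Integrable gr := hgci.comp_neg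
  -- The autocorrelation of `g`: its value at `0` is `∫ g²` and its transform is `|𝓕 g|²`, so
  -- Fourier inversion at the single point `0` is Plancherel's identity.
  set h : ℝ → ℂ := gc ⋆[ContinuousLinearMap.mul ℂ ℂ] gr with hh
  have hhx : ∀ x, h x = ∫ t, ((g t * g (t - x) : ℝ) : ℂ) := fun x => by
    rw [hh, convolution_def]
    refine integral_congr_ae (Eventually.of_forall fun t => ?_)
    simp [hgc, hgr]
  have hFh : 𝓕 h = fun ξ => ((‖𝓕 gc ξ‖ ^ 2 : ℝ) : ℂ) := by
    ext ξ
    rw [hh, Real.fourier_mul_convolution_eq hgci hgri, hgr, fourier_ofReal_comp_neg,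
      Complex.mul_conj, Complex.normSq_eq_norm_sq]
  have hh_int : Integrable h := hgci.integrable_convolution _ hgri
  have hFh_int : Integrable (𝓕 h) := by rw [hFh]; exact hF.ofReal
  -- Pointwise inversion needs continuity at `0`; it follows by dominated convergence, since `g (t -
  -- x) → g t` at almost every `t`.
  have hcont0 : ContinuousAt h 0 := by
    have : h = fun x => ∫ t, ((g t * g (t - x) : ℝ) : ℂ) := funext hhx
    rw [this]
    refine continuousAt_of_dominated (bound := fun t => |g t| * C) ?_ ?_ ?_ ?_
    · refine Eventually.of_forall fun x => ?_
      exact Complex.continuous_ofReal.comp_aestronglyMeasurable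
        (hg.aestronglyMeasurable.mul (hg.comp_sub_right x).aestronglyMeasurable)
    · refine Eventually.of_forall fun x => Eventually.of_forall fun t => ?_
      simp only [Complex.norm_real, norm_mul, Real.norm_eq_abs]
      exact mul_le_mul_of_nonneg_left (hC _) (abs_nonneg _)
    · exact hg.abs.mul_const C
    · filter_upwards [hcont] with t ht
      refine Complex.continuous_ofReal.continuousAt.comp (continuousAt_const.mul ?_)
      refine ContinuousAt.comp (g := g) (f := fun x => t - x) ?_ (by fun_prop)
      simpa using ht
  have key := hh_int.fourierInv_fourier_eq hFh_int hcont0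
  rw [hFh, hhx, Real.fourierInv_eq] at key
  simp only [inner_zero_right, AddChar.map_zero_eq_one, one_smul, integral_complex_ofReal, sub_zero] at key
  have := Complex.ofReal_injective key
  rw [this]
  simp only [pow_two]

/-! ### Differences of step functions and their Fourier transforms -/

/-- The difference `𝟙 {a ≤ w} - 𝟙 {b ≤ w}` of two Heaviside functions. -/
noncomputable def stepDiff (a b w : ℝ) : ℝ :=
  (Ici a).indicator (fun _ => (1 : ℝ)) w - (Ici b).indicator (fun _ => (1 : ℝ)) w

lemma stepDiff_swap (a b w : ℝ) : stepDiff b a w = -stepDiff a b w := by simp [stepDiff]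

lemma stepDiff_of_le {a b : ℝ} (hab : a ≤ b) :
    stepDiff a b = (Ico a b).indicator (fun _ => (1 : ℝ)) := by
  ext w
  by_cases h1 : a ≤ w <;> by_cases h2 : b ≤ w
  · simp [stepDiff, h1, h2]
  · simp [stepDiff, h1, h2, not_le.1 h2]
  · exact absurd (hab.trans h2) h1
  · simp [stepDiff, h1, h2]

lemma abs_stepDiff_le_one (a b w : ℝ) : |stepDiff a b w| ≤ 1 := by
  rcases le_total a b with h | h
  · rw [stepDiff_of_le h]
    by_cases hw : w ∈ Ico a b <;> simp [hw]
  · rw [stepDiff_swap, abs_neg, stepDiff_of_le h]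
    by_cases hw : w ∈ Ico b a <;> simp [hw]

lemma measurable_stepDiff (a b : ℝ) : Measurable (stepDiff a b) :=
  (measurable_const.indicator measurableSet_Ici).sub
    (measurable_const.indicator measurableSet_Ici)

/-- `∫ |𝟙 {a ≤ w} - 𝟙 {b ≤ w}| dw = |a - b|`. -/
lemma lintegral_enorm_stepDiff (a b : ℝ) : ∫⁻ w, ‖stepDiff a b w‖ₑ = ‖a - b‖ₑ := by
  wlog hab : a ≤ b generalizing a b
  · have := this b a (le_of_not_ge hab)
    rw [← enorm_neg, neg_sub, ← this]
    simp_rw [stepDiff_swap b a, enorm_neg]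
  rw [stepDiff_of_le hab]
  simp_rw [enorm_indicator_eq_indicator_enorm]
  rw [lintegral_indicator measurableSet_Ico]
  simp only [enorm_one, lintegral_const, Measure.restrict_apply_univ, Real.volume_Ico, one_mul]
  rw [← enorm_neg, neg_sub, Real.enorm_eq_ofReal (sub_nonneg.2 hab)]

lemma integrable_stepDiff (a b : ℝ) : Integrable (stepDiff a b) := by
  refine ⟨(measurable_stepDiff a b).aestronglyMeasurable, ?_⟩
  rw [HasFiniteIntegral, lintegral_enorm_stepDiff]
  exact enorm_lt_top

/-- `|𝓕 (𝟙_{[a,∞)} - 𝟙_{[b,∞)})(ξ)| ≤ 1 / (π |ξ|)`. -/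
lemma norm_fourier_stepDiff_le (a b : ℝ) {ξ : ℝ} (hξ : ξ ≠ 0) :
    ‖𝓕 (fun w => (stepDiff a b w : ℂ)) ξ‖ ≤ 1 / (Real.pi * |ξ|) := by
  wlog hab : a ≤ b generalizing a b
  · have h := this b a (le_of_not_ge hab)
    have e : 𝓕 (fun w => (stepDiff a b w : ℂ)) ξ = -𝓕 (fun w => (stepDiff b a w : ℂ)) ξ := by
      rw [Real.fourier_real_eq, Real.fourier_real_eq, ← integral_neg]
      refine integral_congr_ae (Eventually.of_forall fun w => ?_)
      simp [stepDiff_swap b a]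
    rwa [e, norm_neg]
  set c : ℂ := -2 * Real.pi * ξ * Complex.I with hc
  have hc0 : c ≠ 0 := by
    simp [hc, Real.pi_ne_zero, hξ]
  have hnc : ‖c‖ = 2 * (Real.pi * |ξ|) := by
    simp [hc, abs_of_pos Real.pi_pos, mul_assoc]
  have h1 : 𝓕 (fun w => (stepDiff a b w : ℂ)) ξ = ∫ w in a..b, Complex.exp (c * w) := by
    rw [Real.fourier_real_eq, stepDiff_of_le hab, intervalIntegral.integral_of_le hab,
      ← integral_Ico_eq_integral_Ioc, ← integral_indicator measurableSet_Ico]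
    refine integral_congr_ae (Eventually.of_forall fun w => ?_)
    by_cases hw : w ∈ Ico a b
    · simp only [hw, indicator_of_mem, Complex.ofReal_one, Circle.smul_def,
        Real.fourierChar_apply, smul_eq_mul, mul_one, hc]
      congr 1
      push_cast
      ring
    · simp [hw]
  rw [h1, integral_exp_mul_complex hc0, norm_div, hnc]
  have hn : ∀ x : ℝ, ‖Complex.exp (c * x)‖ = 1 := fun x => by
    have : c * x = ((-2 * Real.pi * ξ * x : ℝ) : ℂ) * Complex.I := by
      rw [hc]; push_cast; ring
    rw [this, Complex.norm_exp_ofReal_mul_I]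
  have h2 : ‖Complex.exp (c * b) - Complex.exp (c * a)‖ ≤ 2 := by
    refine (norm_sub_le _ _).trans ?_
    rw [hn, hn]; norm_num
  have hp : 0 < Real.pi * |ξ| := mul_pos Real.pi_pos (abs_pos.2 hξ)
  rw [div_le_div_iff₀ (by positivity) hp]
  nlinarith

/-! ### Empirical and smoothed distribution functions -/

/-- The law of `a (I) + ε`, with `I` uniform on `{0, …, n - 1}`, has this distribution function when
`Φ` is the distribution function of `ε`. -/
noncomputable def smoothedCDF (Φ : ℝ → ℝ) (n : ℕ) (a : ℕ → ℝ) (y : ℝ) : ℝ :=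
  (n : ℝ)⁻¹ * ∑ i ∈ Finset.range n, Φ (y - a i)

lemma empiricalCDF_sub (n : ℕ) (a b : ℕ → ℝ) (w : ℝ) :
    empiricalCDF n a w - empiricalCDF n b w
      = (n : ℝ)⁻¹ * ∑ i ∈ Finset.range n, stepDiff (a i) (b i) w := by
  simp only [empiricalCDF, stepDiff, Finset.sum_sub_distrib, mul_sub]

/-- Averages of terms bounded by `c ≥ 0` are bounded by `c`. -/
lemma norm_average_le {E : Type*} [NormedAddCommGroup E] [NormedSpace ℝ E] (n : ℕ) (u : ℕ → E)
    {c : ℝ} (hc : 0 ≤ c) (h : ∀ i, ‖u i‖ ≤ c) :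
    ‖(n : ℝ)⁻¹ • ∑ i ∈ Finset.range n, u i‖ ≤ c := by
  rcases Nat.eq_zero_or_pos n with rfl | hn
  · simpa using hc
  have hn' : (0 : ℝ) < n := Nat.cast_pos.2 hn
  rw [norm_smul, norm_inv, Real.norm_of_nonneg hn'.le, inv_mul_le_iff₀ hn']
  refine (norm_sum_le _ _).trans ?_
  refine (Finset.sum_le_sum fun i _ => h i).trans ?_
  simp

lemma abs_empiricalCDF_sub_le_one (n : ℕ) (a b : ℕ → ℝ) (w : ℝ) :
    |empiricalCDF n a w - empiricalCDF n b w| ≤ 1 := by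
  rw [empiricalCDF_sub]
  exact norm_average_le n (fun i => stepDiff (a i) (b i) w) zero_le_one
    fun i => abs_stepDiff_le_one _ _ _

lemma integrable_empiricalCDF_sub (n : ℕ) (a b : ℕ → ℝ) :
    Integrable fun w => empiricalCDF n a w - empiricalCDF n b w := by
  simp_rw [empiricalCDF_sub]
  exact (integrable_finsetSum _ fun i _ => integrable_stepDiff _ _).const_mul _

lemma MeasureTheory.Integrable.sq_of_abs_le_one {α : Type*} [MeasurableSpace α] {μ : Measure α}
    {g : α → ℝ} (hg : Integrable g μ) (h : ∀ x, |g x| ≤ 1) : Integrable (fun x => g x ^ 2) μ := by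
  refine hg.mono (hg.aestronglyMeasurable.pow 2) (Eventually.of_forall fun x => ?_)
  rw [norm_pow, Real.norm_eq_abs, pow_two]
  exact mul_le_of_le_one_left (abs_nonneg _) (h x)

/-- An average inherits the bound for a single step. Uniformity in `n` and in the points is what
makes the high frequencies harmless. -/
lemma norm_fourier_empiricalCDF_sub_le (n : ℕ) (a b : ℕ → ℝ) {ξ : ℝ} (hξ : ξ ≠ 0) :
    ‖𝓕 (fun w => ((empiricalCDF n a w - empiricalCDF n b w : ℝ) : ℂ)) ξ‖
      ≤ 1 / (Real.pi * |ξ|) := by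
  have : 𝓕 (fun w => ((empiricalCDF n a w - empiricalCDF n b w : ℝ) : ℂ)) ξ
      = (n : ℝ)⁻¹ • ∑ i ∈ Finset.range n, 𝓕 (fun w => (stepDiff (a i) (b i) w : ℂ)) ξ := by
    simp_rw [Real.fourier_real_eq]
    rw [← integral_finsetSum, ← integral_smul]
    · refine integral_congr_ae (Eventually.of_forall fun w => ?_)
      simp only [empiricalCDF_sub, ← Finset.smul_sum, smul_comm (n : ℝ)⁻¹]
      simp
    · intro i _
      have hi : Integrable fun w => (stepDiff (a i) (b i) w : ℂ) :=
        (integrable_stepDiff (a i) (b i)).ofReal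
      have := (Real.fourierIntegral_convergent_iff (V := ℝ) (μ := volume) ξ).2 hi
      simpa [mul_comm] using this
  rw [this]
  exact norm_average_le n _ (by positivity) fun i => norm_fourier_stepDiff_le _ _ hξ

lemma integral_stepDiff_sub (ν : Measure ℝ) [IsProbabilityMeasure ν] (a b y : ℝ) :
    ∫ e, stepDiff a b (y - e) ∂ν = cdf ν (y - a) - cdf ν (y - b) := by
  have h : ∀ c e : ℝ, (Ici c).indicator (fun _ => (1 : ℝ)) (y - e)
      = (Iic (y - c)).indicator (fun _ => (1 : ℝ)) e := fun c e => by
    simp only [indicator, mem_Ici, mem_Iic, le_sub_comm]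
  have hi : ∀ c : ℝ, Integrable ((Iic (y - c)).indicator (fun _ => (1 : ℝ))) ν := fun c =>
    (integrable_const 1).indicator measurableSet_Iic
  simp only [stepDiff, h]
  rw [integral_sub (hi a) (hi b), integral_indicator_const _ measurableSet_Iic,
    integral_indicator_const _ measurableSet_Iic, cdf_eq_real, cdf_eq_real]
  simp

lemma integrable_stepDiff_sub (ν : Measure ℝ) [IsProbabilityMeasure ν] (a b y : ℝ) :
    Integrable (fun e => stepDiff a b (y - e)) ν := by
  refine (integrable_const (1 : ℝ)).mono
    ((measurable_stepDiff a b).comp (measurable_const.sub measurable_id)).aestronglyMeasurable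
    (Eventually.of_forall fun e => ?_)
  simpa using abs_stepDiff_le_one a b (y - e)

lemma smoothedCDF_sub_eq_integral (ν : Measure ℝ) [IsProbabilityMeasure ν] (n : ℕ) (a b : ℕ → ℝ)
    (y : ℝ) :
    smoothedCDF (cdf ν) n a y - smoothedCDF (cdf ν) n b y
      = ∫ e, (empiricalCDF n a (y - e) - empiricalCDF n b (y - e)) ∂ν := by
  simp_rw [empiricalCDF_sub]
  rw [integral_const_mul, integral_finsetSum _ fun i _ => integrable_stepDiff_sub ν _ _ y]
  simp only [integral_stepDiff_sub, smoothedCDF, Finset.sum_sub_distrib, mul_sub]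

lemma IsDensityOf.integrable {f : ℝ → ℝ} {ν : Measure ℝ} [IsProbabilityMeasure ν]
    (hf : IsDensityOf f ν) : Integrable f := by
  refine ⟨hf.1.aestronglyMeasurable, ?_⟩
  rw [hasFiniteIntegral_iff_ofReal (Eventually.of_forall hf.2.1)]
  have : ν univ = ∫⁻ x, ENNReal.ofReal (f x) := by
    conv_lhs => rw [hf.2.2]
    simp
  rw [← this, measure_univ]
  exact ENNReal.one_lt_top

lemma IsDensityOf.integral_eq {f : ℝ → ℝ} {ν : Measure ℝ} (hf : IsDensityOf f ν) (g : ℝ → ℝ) :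
    ∫ x, g x ∂ν = ∫ x, f x * g x := by
  rw [hf.2.2, integral_withDensity_eq_integral_toReal_smul hf.1.ennreal_ofReal
    (Eventually.of_forall fun _ => ENNReal.ofReal_lt_top)]
  refine integral_congr_ae (Eventually.of_forall fun x => ?_)
  simp [ENNReal.toReal_ofReal (hf.2.1 x)]

lemma IsDensityOf.norm_fourier_le_one {f : ℝ → ℝ} {ν : Measure ℝ} [IsProbabilityMeasure ν]
    (hf : IsDensityOf f ν) (ξ : ℝ) : ‖𝓕 (fun x => ((f x : ℝ) : ℂ)) ξ‖ ≤ 1 := by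
  rw [Real.fourier_real_eq]
  refine (norm_integral_le_integral_norm _).trans ?_
  have h := hf.integral_eq fun _ => 1
  simp only [integral_const, probReal_univ, smul_eq_mul, mul_one] at h
  rw [h]
  refine (integral_congr_ae (Eventually.of_forall fun x => ?_)).le
  simp [abs_of_nonneg (hf.2.1 x)]

/-- Passes between the two normalisations; the cut-off `T` for `fourierPhi` becomes `T / (2π)` for
`𝓕`. -/
lemma fourierPhi_eq_fourier (f : ℝ → ℝ) (ξ : ℝ) :
    𝓕 (fun x => ((f x : ℝ) : ℂ)) ξ = fourierPhi f (-(2 * Real.pi * ξ)) := by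
  rw [Real.fourier_real_eq, fourierPhi]
  refine integral_congr_ae (Eventually.of_forall fun x => ?_)
  simp only [Circle.smul_def, Real.fourierChar_apply, smul_eq_mul]
  congr 2
  push_cast
  ring

/-- Convolving a difference of empirical distribution functions with the noise density yields the
difference of the smoothed distribution functions. -/
lemma IsDensityOf.convolution_empiricalCDF_sub {f : ℝ → ℝ} {ν : Measure ℝ} [IsProbabilityMeasure ν]
    (hf : IsDensityOf f ν) (n : ℕ) (a b : ℕ → ℝ) :
    (fun x => ((f x : ℝ) : ℂ)) ⋆[ContinuousLinearMap.mul ℂ ℂ]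
        (fun w => ((empiricalCDF n a w - empiricalCDF n b w : ℝ) : ℂ))
      = fun y => ((smoothedCDF (cdf ν) n a y - smoothedCDF (cdf ν) n b y : ℝ) : ℂ) := by
  ext y
  rw [smoothedCDF_sub_eq_integral, hf.integral_eq, convolution_def, ← integral_complex_ofReal]
  refine integral_congr_ae (Eventually.of_forall fun x => ?_)
  simp

lemma abs_smoothedCDF_sub_le_one (ν : Measure ℝ) [IsProbabilityMeasure ν] (n : ℕ) (a b : ℕ → ℝ)
    (y : ℝ) : |smoothedCDF (cdf ν) n a y - smoothedCDF (cdf ν) n b y| ≤ 1 := by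
  rw [smoothedCDF_sub_eq_integral]
  have h := norm_integral_le_of_norm_le_const (μ := ν) (Eventually.of_forall fun e =>
    (Real.norm_eq_abs _).trans_le (abs_empiricalCDF_sub_le_one n a b (y - e)))
  simpa using h

lemma IsDensityOf.integrable_smoothedCDF_sub {f : ℝ → ℝ} {ν : Measure ℝ} [IsProbabilityMeasure ν]
    (hf : IsDensityOf f ν) (n : ℕ) (a b : ℕ → ℝ) :
    Integrable fun y => smoothedCDF (cdf ν) n a y - smoothedCDF (cdf ν) n b y := by
  have hfc : Integrable fun x => ((f x : ℝ) : ℂ) := hf.integrable.ofReal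
  have hD : Integrable fun w => ((empiricalCDF n a w - empiricalCDF n b w : ℝ) : ℂ) :=
    (integrable_empiricalCDF_sub n a b).ofReal
  have h := hfc.integrable_convolution (ContinuousLinearMap.mul ℂ ℂ) hD
  rw [hf.convolution_empiricalCDF_sub] at h
  simpa using h.re

lemma Monotone.smoothedCDF {Φ : ℝ → ℝ} (hΦ : Monotone Φ) (n : ℕ) (a : ℕ → ℝ) :
    Monotone (smoothedCDF Φ n a) := fun _ _ h =>
  mul_le_mul_of_nonneg_left
    (Finset.sum_le_sum fun _ _ => hΦ (sub_le_sub_right h _)) (by positivity)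

lemma Monotone.empiricalCDF (n : ℕ) (a : ℕ → ℝ) : Monotone (empiricalCDF n a) := fun x y h => by
  refine mul_le_mul_of_nonneg_left (Finset.sum_le_sum fun i _ => ?_) (by positivity)
  by_cases hx : a i ≤ x
  · simp [hx, hx.trans h]
  · simp only [indicator, mem_Ici, hx, if_false]
    split_ifs <;> norm_num

lemma Monotone.ae_continuousAt {g : ℝ → ℝ} (hg : Monotone g) : ∀ᵐ x, ContinuousAt g x :=
  hg.countable_not_continuousAt.measure_zero volume

/-! ### Passage to the Fourier side and deconvolution -/

/-- The Fourier transform of a difference of empirical distribution functions is square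
integrable. -/
lemma integrable_norm_fourier_empiricalCDF_sub_sq (n : ℕ) (a b : ℕ → ℝ) :
    Integrable fun ξ =>
      ‖𝓕 (fun w => ((empiricalCDF n a w - empiricalCDF n b w : ℝ) : ℂ)) ξ‖ ^ 2 := by
  set D : ℝ → ℂ := fun w => ((empiricalCDF n a w - empiricalCDF n b w : ℝ) : ℂ) with hD
  have hDi : Integrable D := (integrable_empiricalCDF_sub n a b).ofReal
  have hcont : Continuous (𝓕 D) :=
    VectorFourier.fourierIntegral_continuous Real.continuous_fourierChar
      (by exact continuous_inner) hDi
  set M : ℝ := ∫ w, ‖D w‖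
  have hM : 0 ≤ M := integral_nonneg fun _ => norm_nonneg _
  have h1 : ∀ ξ, ‖𝓕 D ξ‖ ≤ M := fun ξ =>
    VectorFourier.norm_fourierIntegral_le_integral_norm _ _ _ _ _
  -- `‖𝓕 D‖ ≤ M` handles low frequencies and `‖𝓕 D‖ |ξ| ≤ 1` high ones; adding the squares gives the
  -- majorant `(M² + 1) / (1 + ξ²)`.
  refine (integrable_inv_one_add_sq.const_mul (M ^ 2 + 1)).mono
    (hcont.norm.pow 2).aestronglyMeasurable ?_
  have h0 : ∀ᵐ ξ : ℝ, ξ ≠ 0 := by simp [ae_iff]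
  filter_upwards [h0] with ξ hξ
  have hpos : 0 < 1 + ξ ^ 2 := by positivity
  rw [Real.norm_of_nonneg (by positivity), Real.norm_of_nonneg (by positivity),
    ← div_eq_mul_inv, le_div_iff₀ hpos]
  have h2 : ‖𝓕 D ξ‖ * |ξ| ≤ 1 := by
    have h := norm_fourier_empiricalCDF_sub_le n a b hξ
    have hξ' := abs_pos.2 hξ
    rw [le_div_iff₀ (mul_pos Real.pi_pos hξ')] at h
    have hpi : 1 ≤ Real.pi := by linarith [Real.pi_gt_three]
    refine le_trans ?_ h
    refine mul_le_mul_of_nonneg_left ?_ (norm_nonneg _)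
    nlinarith
  have h3 : ‖𝓕 D ξ‖ ^ 2 * ξ ^ 2 ≤ 1 := by
    rw [← sq_abs ξ, ← mul_pow]
    exact pow_le_one₀ (by positivity) h2
  have h4 : ‖𝓕 D ξ‖ ^ 2 ≤ M ^ 2 := pow_le_pow_left₀ (norm_nonneg _) (h1 ξ) 2
  nlinarith

lemma integral_empiricalCDF_sub_sq (n : ℕ) (a b : ℕ → ℝ) :
    ∫ w, (empiricalCDF n a w - empiricalCDF n b w) ^ 2
      = ∫ ξ, ‖𝓕 (fun w => ((empiricalCDF n a w - empiricalCDF n b w : ℝ) : ℂ)) ξ‖ ^ 2 := by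
  refine integral_sq_eq_integral_norm_fourier_sq (integrable_empiricalCDF_sub n a b)
    (abs_empiricalCDF_sub_le_one n a b) ?_ (integrable_norm_fourier_empiricalCDF_sub_sq n a b)
  filter_upwards [(Monotone.empiricalCDF n a).ae_continuousAt,
    (Monotone.empiricalCDF n b).ae_continuousAt] with x h1 h2 using h1.sub h2

lemma IsDensityOf.fourier_smoothedCDF_sub {f : ℝ → ℝ} {ν : Measure ℝ} [IsProbabilityMeasure ν]
    (hf : IsDensityOf f ν) (n : ℕ) (a b : ℕ → ℝ) (ξ : ℝ) :
    𝓕 (fun y => ((smoothedCDF (cdf ν) n a y - smoothedCDF (cdf ν) n b y : ℝ) : ℂ)) ξ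
      = 𝓕 (fun x => ((f x : ℝ) : ℂ)) ξ
        * 𝓕 (fun w => ((empiricalCDF n a w - empiricalCDF n b w : ℝ) : ℂ)) ξ := by
  rw [← hf.convolution_empiricalCDF_sub]
  exact Real.fourier_mul_convolution_eq hf.integrable.ofReal
    (integrable_empiricalCDF_sub n a b).ofReal ξ

lemma IsDensityOf.continuous_fourier {f : ℝ → ℝ} {ν : Measure ℝ} [IsProbabilityMeasure ν]
    (hf : IsDensityOf f ν) : Continuous (𝓕 (fun x => ((f x : ℝ) : ℂ))) :=
  VectorFourier.fourierIntegral_continuous Real.continuous_fourierChar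
    (by exact continuous_inner) hf.integrable.ofReal

lemma IsDensityOf.integrable_norm_fourier_mul_sq {f : ℝ → ℝ} {ν : Measure ℝ}
    [IsProbabilityMeasure ν] (hf : IsDensityOf f ν) (n : ℕ) (a b : ℕ → ℝ) :
    Integrable fun ξ => ‖𝓕 (fun x => ((f x : ℝ) : ℂ)) ξ
      * 𝓕 (fun w => ((empiricalCDF n a w - empiricalCDF n b w : ℝ) : ℂ)) ξ‖ ^ 2 := by
  simp_rw [norm_mul, mul_pow]
  refine (integrable_norm_fourier_empiricalCDF_sub_sq n a b).bdd_mul (c := 1)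
    (hf.continuous_fourier.norm.pow 2).aestronglyMeasurable (Eventually.of_forall fun ξ => ?_)
  rw [norm_pow, norm_norm]
  exact pow_le_one₀ (norm_nonneg _) (hf.norm_fourier_le_one ξ)

lemma IsDensityOf.integral_smoothedCDF_sub_sq {f : ℝ → ℝ} {ν : Measure ℝ}
    [IsProbabilityMeasure ν] (hf : IsDensityOf f ν) (n : ℕ) (a b : ℕ → ℝ) :
    ∫ y, (smoothedCDF (cdf ν) n a y - smoothedCDF (cdf ν) n b y) ^ 2
      = ∫ ξ, ‖𝓕 (fun x => ((f x : ℝ) : ℂ)) ξ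
        * 𝓕 (fun w => ((empiricalCDF n a w - empiricalCDF n b w : ℝ) : ℂ)) ξ‖ ^ 2 := by
  simp_rw [← hf.fourier_smoothedCDF_sub]
  refine integral_sq_eq_integral_norm_fourier_sq (hf.integrable_smoothedCDF_sub n a b)
    (abs_smoothedCDF_sub_le_one ν n a b) ?_ ?_
  · have hm := monotone_cdf ν
    filter_upwards [(hm.smoothedCDF n a).ae_continuousAt, (hm.smoothedCDF n b).ae_continuousAt]
      with x h1 h2 using h1.sub h2
  · simp_rw [hf.fourier_smoothedCDF_sub]
    exact hf.integrable_norm_fourier_mul_sq n a b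

/-- `∫_{|ξ| > r} dξ / (π ξ)² ≤ 2 / r`, in truncated form. -/
lemma integral_indicator_inv_sq_le {r : ℝ} (hr : 0 < r) :
    Integrable ({ξ : ℝ | r < |ξ|}.indicator fun ξ => (1 / (Real.pi * |ξ|)) ^ 2) ∧
    ∫ ξ, ({ξ : ℝ | r < |ξ|}.indicator fun ξ => (1 / (Real.pi * |ξ|)) ^ 2) ξ ≤ 2 / r := by
  set k : ℝ → ℝ := (Ioi r).indicator fun ξ => ξ ^ (-2 : ℝ) with hk
  have hki : Integrable k :=
    (integrable_indicator_iff measurableSet_Ioi).2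
      (integrableOn_Ioi_rpow_of_lt (by norm_num) hr)
  have hkint : ∫ ξ, k ξ = 1 / r := by
    rw [hk, integral_indicator measurableSet_Ioi, integral_Ioi_rpow_of_lt (by norm_num) hr]
    norm_num
    rw [Real.rpow_neg_one]
  have hbound : ∀ ξ, ({ξ : ℝ | r < |ξ|}.indicator fun ξ => (1 / (Real.pi * |ξ|)) ^ 2) ξ
      ≤ k ξ + k (-ξ) := fun ξ => by
    have hk0 : ∀ x, 0 ≤ k x := fun x => indicator_nonneg (fun y hy =>
      Real.rpow_nonneg (hr.le.trans (le_of_lt hy)) _) x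
    by_cases hξ : r < |ξ|
    · have hp : (1 / (Real.pi * |ξ|)) ^ 2 ≤ (|ξ|) ^ (-2 : ℝ) := by
        have h0 : 0 < |ξ| := hr.trans hξ
        rw [Real.rpow_neg h0.le, Real.rpow_two, ← one_div, div_pow, one_pow]
        refine one_div_le_one_div_of_le (by positivity) ?_
        refine pow_le_pow_left₀ h0.le ?_ 2
        nlinarith [Real.pi_gt_three]
      rw [indicator_of_mem (by exact hξ)]
      refine hp.trans ?_
      rcases abs_cases ξ with ⟨h, _⟩ | ⟨h, _⟩
      · have : k ξ = |ξ| ^ (-2 : ℝ) := by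
          rw [hk, indicator_of_mem (by rw [h] at hξ; exact hξ), h]
        linarith [hk0 (-ξ)]
      · have : k (-ξ) = |ξ| ^ (-2 : ℝ) := by
          rw [hk, indicator_of_mem (by rw [h] at hξ; exact hξ), h]
        linarith [hk0 ξ]
    · rw [indicator_of_notMem (by exact hξ)]
      exact add_nonneg (hk0 _) (hk0 _)
  have hmeas : Measurable ({ξ : ℝ | r < |ξ|}.indicator fun ξ => (1 / (Real.pi * |ξ|)) ^ 2) :=
    Measurable.indicator (by fun_prop) (measurableSet_lt measurable_const measurable_norm)
  have hi : Integrable ({ξ : ℝ | r < |ξ|}.indicator fun ξ => (1 / (Real.pi * |ξ|)) ^ 2) := by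
    refine (hki.add hki.comp_neg).mono hmeas.aestronglyMeasurable
      (Eventually.of_forall fun ξ => ?_)
    rw [Real.norm_of_nonneg (indicator_nonneg (fun _ _ => by positivity) _)]
    exact (hbound ξ).trans (le_abs_self _)
  refine ⟨hi, (integral_mono hi (hki.add hki.comp_neg) hbound).trans ?_⟩
  refine (integral_add hki hki.comp_neg).le.trans ?_
  rw [integral_neg_eq_self, hkint]
  exact le_of_eq (by ring)

/-- Deconvolution inequality: for ordinary smooth noise, the `L²` distance of two empirical
distribution functions is controlled by the one of the smoothed distribution functions. -/
lemma IsDensityOf.exists_integral_empiricalCDF_sub_sq_le {f : ℝ → ℝ} {ν : Measure ℝ}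
    [IsProbabilityMeasure ν] (hf : IsDensityOf f ν) {β : ℝ} (hf_smooth : OrdinarySmooth f β)
    (hf_min : EventuallyMinimalFourier f) :
    ∃ C T₁ : ℝ, 0 < C ∧ 0 < T₁ ∧ ∀ T ≥ T₁, ∀ (n : ℕ) (a b : ℕ → ℝ),
      ∫ w, (empiricalCDF n a w - empiricalCDF n b w) ^ 2
        ≤ C * (T ^ (2 * β)
          * (∫ y, (smoothedCDF (cdf ν) n a y - smoothedCDF (cdf ν) n b y) ^ 2) + 1 / T) := by
  obtain ⟨d₀, d₁, R, hd₀, hd₁, hR, hsm⟩ := hf_smooth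
  obtain ⟨T₀, hmin⟩ := hf_min
  have hpi := Real.pi_pos
  -- `1 / d₀²` is the price of dividing by `φ`; `4π` is the tail bound `2 / r` at `r = T / (2π)`.
  -- The threshold ensures both `R ≤ T` and `T₀ < T`.
  refine ⟨1 / d₀ ^ 2 + 4 * Real.pi, max R (T₀ + 1), by positivity,
    hR.trans_le (le_max_left _ _), fun T hT n a b => ?_⟩
  have hTR : R ≤ T := (le_max_left _ _).trans hT
  have hT0 : 0 < T := hR.trans_le hTR
  have hTT : T₀ < T := (lt_add_one T₀).trans_le ((le_max_right _ _).trans hT)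
  set φ : ℝ → ℂ := 𝓕 (fun x => ((f x : ℝ) : ℂ)) with hφ
  set D : ℝ → ℂ := 𝓕 (fun w => ((empiricalCDF n a w - empiricalCDF n b w : ℝ) : ℂ)) with hD
  have hr : 0 < T / (2 * Real.pi) := by positivity
  obtain ⟨htail_i, htail⟩ := integral_indicator_inv_sq_le hr
  have hG := hf.integrable_norm_fourier_mul_sq n a b
  -- Ordinary smoothness is applied only at `T`; the minimality of `|φ(T)|` on `[-T, T]` carries the
  -- bound to all lower frequencies.
  have hlow : ∀ ξ, |ξ| ≤ T / (2 * Real.pi) → d₀ / T ^ β ≤ ‖φ ξ‖ := fun ξ hξ => by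
    have h1 := (hsm T (by rwa [abs_of_pos hT0])).1
    rw [abs_of_pos hT0] at h1
    refine h1.trans ?_
    rw [hφ, fourierPhi_eq_fourier]
    refine (hmin T hTT _ ?_).1
    rw [abs_neg, abs_mul, abs_of_pos (by positivity : (0 : ℝ) < 2 * Real.pi)]
    rwa [le_div_iff₀ (by positivity), mul_comm] at hξ
  have hTβ : 0 < T ^ β := Real.rpow_pos_of_pos hT0 β
  have hpt : ∀ᵐ ξ : ℝ, ‖D ξ‖ ^ 2 ≤ T ^ (2 * β) / d₀ ^ 2 * ‖φ ξ * D ξ‖ ^ 2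
      + ({ξ : ℝ | T / (2 * Real.pi) < |ξ|}.indicator fun ξ => (1 / (Real.pi * |ξ|)) ^ 2) ξ := by
    have h0 : ∀ᵐ ξ : ℝ, ξ ≠ 0 := by simp [ae_iff]
    filter_upwards [h0] with ξ hξ0
    by_cases hξ : T / (2 * Real.pi) < |ξ|
    · rw [indicator_of_mem (by exact hξ)]
      have := pow_le_pow_left₀ (norm_nonneg _) (norm_fourier_empiricalCDF_sub_le n a b hξ0) 2
      have h2 : 0 ≤ T ^ (2 * β) / d₀ ^ 2 * ‖φ ξ * D ξ‖ ^ 2 := by positivity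
      linarith
    · rw [indicator_of_notMem (by exact hξ), add_zero]
      have h1 := hlow ξ (not_lt.1 hξ)
      rw [div_le_iff₀ hTβ] at h1
      have h2 : d₀ ^ 2 ≤ (‖φ ξ‖ * T ^ β) ^ 2 := pow_le_pow_left₀ hd₀.le h1 2
      rw [mul_comm 2 β, Real.rpow_mul hT0.le, Real.rpow_two, norm_mul, div_mul_eq_mul_div,
        le_div_iff₀ (by positivity)]
      nlinarith [sq_nonneg ‖D ξ‖]
  rw [integral_empiricalCDF_sub_sq, hf.integral_smoothedCDF_sub_sq]
  refine (integral_mono_ae (integrable_norm_fourier_empiricalCDF_sub_sq n a b)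
    ((hG.const_mul _).add htail_i) hpt).trans ?_
  refine (integral_add (hG.const_mul _) htail_i).le.trans ?_
  rw [integral_const_mul]
  set I : ℝ := ∫ ξ, ‖φ ξ * D ξ‖ ^ 2
  have hI : 0 ≤ I := integral_nonneg fun _ => by positivity
  have h1 : 2 / (T / (2 * Real.pi)) = 4 * Real.pi * (1 / T) := by field_simp; norm_num
  rw [h1] at htail
  have h2 : 0 ≤ 1 / d₀ ^ 2 * (1 / T) := by positivity
  have h3 : 0 ≤ 4 * Real.pi * (T ^ (2 * β) * I) := by positivity
  have h4 : T ^ (2 * β) / d₀ ^ 2 * I = 1 / d₀ ^ 2 * (T ^ (2 * β) * I) := by ring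
  nlinarith

/-! ### Integrability of the contrast -/

lemma indicator_sub_cdf_eq_integral (ν : Measure ℝ) [IsProbabilityMeasure ν] (y a z : ℝ) :
    (Ici y).indicator (fun _ => (1 : ℝ)) z - cdf ν (z - a) = ∫ e, stepDiff y (a + e) z ∂ν := by
  have h : (fun e => stepDiff y (a + e) z)
      = fun e => (Ici y).indicator (fun _ => (1 : ℝ)) z
        - (Iic (z - a)).indicator (fun _ => (1 : ℝ)) e := by
    ext e
    simp only [stepDiff, indicator, mem_Ici, mem_Iic, le_sub_iff_add_le']
  rw [h, integral_sub (integrable_const _) ((integrable_const 1).indicator measurableSet_Iic),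
    integral_indicator_const _ measurableSet_Iic, cdf_eq_real]
  simp

lemma measurable_stepDiff_uncurry :
    Measurable fun p : ℝ × ℝ × ℝ => stepDiff p.1 p.2.1 p.2.2 := by
  have h : (fun p : ℝ × ℝ × ℝ => stepDiff p.1 p.2.1 p.2.2)
      = fun p => {p : ℝ × ℝ × ℝ | p.1 ≤ p.2.2}.indicator (fun _ => (1 : ℝ)) p
        - {p : ℝ × ℝ × ℝ | p.2.1 ≤ p.2.2}.indicator (fun _ => (1 : ℝ)) p := by
    ext p
    simp only [stepDiff, indicator, mem_Ici, mem_ofPred_eq]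
  rw [h]
  exact (measurable_const.indicator (measurableSet_le (by fun_prop) (by fun_prop))).sub
    (measurable_const.indicator (measurableSet_le (by fun_prop) (by fun_prop)))

/-- `∫ |𝟙 {y ≤ z} - Φ(z - a)| dz ≤ |y| + |a| + E|ε|`. -/
lemma lintegral_enorm_indicator_sub_cdf_le (ν : Measure ℝ) [IsProbabilityMeasure ν] (y a : ℝ) :
    ∫⁻ z, ‖(Ici y).indicator (fun _ => (1 : ℝ)) z - cdf ν (z - a)‖ₑ
      ≤ ‖y‖ₑ + ‖a‖ₑ + ∫⁻ e, ‖e‖ₑ ∂ν := by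
  have hmeas : Measurable fun p : ℝ × ℝ => ‖stepDiff y (a + p.2) p.1‖ₑ :=
    (measurable_stepDiff_uncurry.comp
      (by fun_prop : Measurable fun p : ℝ × ℝ => (y, a + p.2, p.1))).enorm
  calc ∫⁻ z, ‖(Ici y).indicator (fun _ => (1 : ℝ)) z - cdf ν (z - a)‖ₑ
      ≤ ∫⁻ z, ∫⁻ e, ‖stepDiff y (a + e) z‖ₑ ∂ν := lintegral_mono fun z => by
        rw [indicator_sub_cdf_eq_integral]
        exact enorm_integral_le_lintegral_enorm _
    _ = ∫⁻ e, (∫⁻ z, ‖stepDiff y (a + e) z‖ₑ) ∂ν := lintegral_lintegral_swap hmeas.aemeasurable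
    _ ≤ ∫⁻ e, (‖y‖ₑ + ‖a‖ₑ + ‖e‖ₑ) ∂ν := by
        refine lintegral_mono fun e => ?_
        simp only [lintegral_enorm_stepDiff, add_assoc]
        refine (enorm_sub_le).trans (add_le_add_right (enorm_add_le _ _) _)
    _ = ‖y‖ₑ + ‖a‖ₑ + ∫⁻ e, ‖e‖ₑ ∂ν := by
        rw [lintegral_add_left measurable_const]
        simp

lemma measurable_indicator_Ici_sub_cdf (ν : Measure ℝ) [IsProbabilityMeasure ν] (y a : ℝ) :
    Measurable fun z => (Ici y).indicator (fun _ => (1 : ℝ)) z - cdf ν (z - a) :=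
  (measurable_const.indicator measurableSet_Ici).sub
    ((monotone_cdf ν).measurable.comp (measurable_id.sub_const a))

lemma integrable_indicator_sub_cdf {ν : Measure ℝ} [IsProbabilityMeasure ν]
    (hν : Integrable (fun e : ℝ => e) ν) (y a : ℝ) :
    Integrable fun z => (Ici y).indicator (fun _ => (1 : ℝ)) z - cdf ν (z - a) := by
  refine ⟨(measurable_indicator_Ici_sub_cdf ν y a).aestronglyMeasurable, ?_⟩
  refine (lintegral_enorm_indicator_sub_cdf_le ν y a).trans_lt ?_
  exact ENNReal.add_lt_top.2 ⟨ENNReal.add_lt_top.2 ⟨enorm_lt_top, enorm_lt_top⟩, hν.2⟩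

lemma abs_indicator_sub_cdf_le_one (ν : Measure ℝ) [IsProbabilityMeasure ν] (y z a : ℝ) :
    |(Ici y).indicator (fun _ => (1 : ℝ)) z - cdf ν a| ≤ 1 := by
  have h1 := cdf_nonneg ν a
  have h2 := cdf_le_one ν a
  by_cases h : y ≤ z
  · simp only [indicator, mem_Ici, h, if_true, abs_le]
    constructor <;> linarith
  · simp only [indicator, mem_Ici, h, if_false, abs_le]
    constructor <;> linarith

lemma empiricalCDF_sub_smoothedCDF (Φ : ℝ → ℝ) (n : ℕ) (y a : ℕ → ℝ) (z : ℝ) :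
    empiricalCDF n y z - smoothedCDF Φ n a z = (n : ℝ)⁻¹ * ∑ i ∈ Finset.range n,
      ((Ici (y i)).indicator (fun _ => (1 : ℝ)) z - Φ (z - a i)) := by
  simp only [empiricalCDF, smoothedCDF, Finset.sum_sub_distrib, mul_sub]

lemma abs_empiricalCDF_sub_smoothedCDF_le_one (ν : Measure ℝ) [IsProbabilityMeasure ν] (n : ℕ)
    (y a : ℕ → ℝ) (z : ℝ) : |empiricalCDF n y z - smoothedCDF (cdf ν) n a z| ≤ 1 := by
  rw [empiricalCDF_sub_smoothedCDF]
  exact norm_average_le n (fun i => (Ici (y i)).indicator (fun _ => (1 : ℝ)) z - cdf ν (z - a i))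
    zero_le_one fun i => abs_indicator_sub_cdf_le_one _ _ _ _

/-- The finite first moment of the noise makes the criterion a genuine integral for every `m`, not
the default value `0`. -/
lemma integrable_empiricalCDF_sub_smoothedCDF_sq {ν : Measure ℝ} [IsProbabilityMeasure ν]
    (hν : Integrable (fun e : ℝ => e) ν) (n : ℕ) (y a : ℕ → ℝ) :
    Integrable fun z => (empiricalCDF n y z - smoothedCDF (cdf ν) n a z) ^ 2 := by
  refine Integrable.sq_of_abs_le_one ?_ (abs_empiricalCDF_sub_smoothedCDF_le_one ν n y a)
  simp_rw [empiricalCDF_sub_smoothedCDF]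
  exact (integrable_finsetSum _ fun i _ => integrable_indicator_sub_cdf hν _ _).const_mul _

/-! ### The basic inequality for the estimator -/

lemma continuousWithinAt_Ici_ite_le (p A B t : ℝ) :
    ContinuousWithinAt (fun s => if p ≤ s then A else B) (Ici t) t := by
  by_cases h : p ≤ t
  · refine (continuousWithinAt_const (b := A)).congr (fun s hs => ?_) ?_
    · simp [h.trans hs]
    · simp [h]
  · refine ContinuousAt.continuousWithinAt ((continuousAt_const (y := B)).congr ?_)
    filter_upwards [Iio_mem_nhds (not_le.1 h)] with s hs
    simp [not_le.2 (show s < p from hs)]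

/-- A monotone function on `[0,1]` agrees at finitely many points with a right-continuous one. -/
lemma MonotoneOn.exists_mem_monotoneClass {m₀ : ℝ → ℝ} (hm₀ : MonotoneOn m₀ (Icc 0 1)) {n : ℕ}
    (hn : 0 < n) {x : ℕ → ℝ} (hx : ∀ i < n, x i ∈ Icc (0 : ℝ) 1) :
    ∃ m ∈ monotoneClass, ∀ i < n, m (x i) = m₀ (x i) := by
  have h0 : (0 : ℝ) ∈ Icc (0 : ℝ) 1 := by simp
  have h1 : (1 : ℝ) ∈ Icc (0 : ℝ) 1 := by simp
  have hne : (Finset.range n).Nonempty := Finset.nonempty_range_iff.2 hn.ne'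
  have hlow : ∀ i < n, m₀ 0 ≤ m₀ (x i) := fun i hi => hm₀ h0 (hx i hi) (hx i hi).1
  have hup : ∀ i < n, m₀ (x i) ≤ m₀ 1 := fun i hi => hm₀ (hx i hi) h1 (hx i hi).2
  -- Right-continuous steps, jumping from `m₀ 0` to `m₀ (x i)` at `x i`. By monotonicity of `m₀`,
  -- their maximum interpolates `m₀` at the design points.
  set u : ℕ → ℝ → ℝ := fun i t => if x i ≤ t then m₀ (x i) else m₀ 0 with hu
  have hu_low : ∀ i < n, ∀ t, m₀ 0 ≤ u i t := fun i hi t => by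
    simp only [hu]; split_ifs
    · exact hlow i hi
    · exact le_rfl
  have hu_up : ∀ i < n, ∀ t, u i t ≤ m₀ 1 := fun i hi t => by
    simp only [hu]; split_ifs
    · exact hup i hi
    · exact (hlow i hi).trans (hup i hi)
  have hu_mono : ∀ i < n, Monotone (u i) := fun i hi s t hst => by
    by_cases hs : x i ≤ s
    · simp [hu, hs, hs.trans hst]
    · have : u i s = m₀ 0 := by simp [hu, hs]
      rw [this]
      exact hu_low i hi t
  refine ⟨fun t => (Finset.range n).sup' hne fun i => u i t, ⟨⟨max |m₀ 0| |m₀ 1|, ?_⟩, ?_, ?_⟩, ?_⟩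
  · intro t _
    refine abs_le_max_abs_abs ?_ (Finset.sup'_le _ _ fun i hi => hu_up i (Finset.mem_range.1 hi) t)
    exact (hu_low 0 hn t).trans (Finset.le_sup' (fun i => u i t) (Finset.mem_range.2 hn))
  · intro s _ t _ hst
    exact Finset.sup'_mono_fun fun i hi => hu_mono i (Finset.mem_range.1 hi) hst
  · intro t _
    exact ContinuousWithinAt.finset_sup'_apply hne fun i _ =>
      (continuousWithinAt_Ici_ite_le _ _ _ _).mono inter_subset_left
  · intro j hj
    refine le_antisymm (Finset.sup'_le _ _ fun i hi => ?_) ?_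
    · simp only [hu]; split_ifs with h
      · exact hm₀ (hx i (Finset.mem_range.1 hi)) (hx j hj) h
      · exact hlow j hj
    · refine le_trans ?_ (Finset.le_sup' (fun i => u i (x j)) (Finset.mem_range.2 hj))
      simp [hu]

/-- The basic inequality for minimum contrast estimators. -/
lemma IsMinContrast.integral_smoothedCDF_sub_sq_le {f : ℝ → ℝ} {ν : Measure ℝ}
    [IsProbabilityMeasure ν] (hf : IsDensityOf f ν) (hν : Integrable (fun e : ℝ => e) ν)
    {m₀ : ℝ → ℝ} (hm₀ : MonotoneOn m₀ (Icc 0 1)) {n : ℕ} (hn : 0 < n) {x y : ℕ → ℝ}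
    (hx : ∀ i < n, x i ∈ Icc (0 : ℝ) 1) {m : ℝ → ℝ} (hm : IsMinContrast (cdf ν) n x y m) :
    ∫ z, (smoothedCDF (cdf ν) n (fun i => m (x i)) z
        - smoothedCDF (cdf ν) n (fun i => m₀ (x i)) z) ^ 2
      ≤ 4 * ∫ z, (empiricalCDF n y z - smoothedCDF (cdf ν) n (fun i => m₀ (x i)) z) ^ 2 := by
  obtain ⟨m', hm', hm'x⟩ := hm₀.exists_mem_monotoneClass hn hx
  have heq : smoothedCDF (cdf ν) n (fun i => m' (x i))
      = smoothedCDF (cdf ν) n (fun i => m₀ (x i)) := by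
    ext z
    refine congrArg _ (Finset.sum_congr rfl fun i hi => ?_)
    simp only [hm'x i (Finset.mem_range.1 hi)]
  -- `m₀` need not be right-continuous, so the competitor is `m'`, which has the same criterion
  -- because only values at the `x i` enter.
  have hle : ∫ z, (empiricalCDF n y z - smoothedCDF (cdf ν) n (fun i => m (x i)) z) ^ 2
      ≤ ∫ z, (empiricalCDF n y z - smoothedCDF (cdf ν) n (fun i => m₀ (x i)) z) ^ 2 := by
    rw [← heq]
    exact hm.2 m' hm'
  have hi1 := integrable_empiricalCDF_sub_smoothedCDF_sq hν n y fun i => m (x i)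
  have hi2 := integrable_empiricalCDF_sub_smoothedCDF_sq hν n y fun i => m₀ (x i)
  have hG := (hf.integrable_smoothedCDF_sub n (fun i => m (x i)) fun i => m₀ (x i)).sq_of_abs_le_one
    (abs_smoothedCDF_sub_le_one ν n _ _)
  -- `(u - v)² ≤ 2u² + 2v²`; minimality then bounds both integrals by the same one, whence the
  -- factor 4.
  have := integral_mono hG ((hi1.const_mul 2).add (hi2.const_mul 2)) fun z => by
    simp only [Pi.add_apply]
    nlinarith [sq_nonneg (empiricalCDF n y z - smoothedCDF (cdf ν) n (fun i => m (x i)) z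
      + (empiricalCDF n y z - smoothedCDF (cdf ν) n (fun i => m₀ (x i)) z))]
  refine this.trans ((integral_add (hi1.const_mul 2) (hi2.const_mul 2)).le.trans ?_)
  rw [integral_const_mul, integral_const_mul]
  linarith

/-! ### The stochastic bound -/

/-- The variance of an average of independent `[0,1]`-valued variables, bounded by mean absolute
deviations from an arbitrary point of `[0,1]`. -/
lemma ProbabilityTheory.iIndepFun.lintegral_average_sub_sq_le {Ω : Type*} [MeasurableSpace Ω]
    {P : Measure Ω} [IsProbabilityMeasure P] {W : ℕ → Ω → ℝ} (hW : iIndepFun W P)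
    (hmeas : ∀ i, AEMeasurable (W i) P) (h01 : ∀ i ω, W i ω ∈ Icc (0 : ℝ) 1) {h c : ℝ}
    (hmean : ∀ i, ∫ ω, W i ω ∂P = h) (hc : c ∈ Icc (0 : ℝ) 1) {n : ℕ} (hn : 0 < n) :
    ∫⁻ ω, ‖(n : ℝ)⁻¹ * ∑ i ∈ Finset.range n, W i ω - h‖ₑ ^ 2 ∂P
      ≤ ENNReal.ofReal (((n : ℝ)⁻¹) ^ 2) * ∑ i ∈ Finset.range n, ∫⁻ ω, ‖W i ω - c‖ₑ ∂P := by
  have hLp : ∀ i, MemLp (W i) 2 P := fun i =>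
    MemLp.of_bound (hmeas i).aestronglyMeasurable 1 (Eventually.of_forall fun ω => by
      rw [Real.norm_of_nonneg (h01 i ω).1]; exact (h01 i ω).2)
  have hint : ∀ i, Integrable (W i) P := fun i => (hLp i).integrable one_le_two
  -- `Var W = Var (W - c) ≤ E (W - c)² ≤ E |W - c|`, as `|W - c| ≤ 1`.
  have hvar : ∀ i, variance (W i) P ≤ ∫ ω, ‖W i ω - c‖ ∂P := fun i => by
    rw [← variance_sub_const (hmeas i).aestronglyMeasurable c]
    refine (variance_le_expectation_sq ((hmeas i).sub_const c).aestronglyMeasurable).trans ?_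
    have hL := ((hLp i).sub (memLp_const c)).integrable_sq
    refine integral_mono hL ((hint i).sub (integrable_const c)).norm fun ω => ?_
    have h1 : ‖W i ω - c‖ ≤ 1 := by
      rw [Real.norm_eq_abs, abs_le]
      have := h01 i ω
      constructor <;> linarith [this.1, this.2, hc.1, hc.2]
    simp only [Pi.pow_apply]
    rw [← Real.norm_of_nonneg (sq_nonneg (W i ω - c)), norm_pow, pow_two]
    exact mul_le_of_le_one_left (norm_nonneg _) h1
  have hn' : (n : ℝ) ≠ 0 := Nat.cast_ne_zero.2 hn.ne'
  have hE : ∫ ω, (n : ℝ)⁻¹ * ∑ i ∈ Finset.range n, W i ω ∂P = h := by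
    rw [integral_const_mul, integral_finsetSum _ fun i _ => hint i]
    simp [hmean, hn']
  have hsumLp : MemLp (fun ω => ∑ i ∈ Finset.range n, W i ω) 2 P :=
    memLp_finsetSum _ fun i _ => hLp i
  have hev : ∫⁻ ω, ‖(n : ℝ)⁻¹ * ∑ i ∈ Finset.range n, W i ω - h‖ₑ ^ 2 ∂P
      = evariance (fun ω => (n : ℝ)⁻¹ * ∑ i ∈ Finset.range n, W i ω) P := by
    rw [evariance, hE]
  have hsum : variance (fun ω => ∑ i ∈ Finset.range n, W i ω) P
      = ∑ i ∈ Finset.range n, variance (W i) P := by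
    rw [← IndepFun.variance_sum (fun i _ => hLp i) fun i _ j _ hij => hW.indepFun hij]
    congr 1
    ext ω
    simp
  rw [hev, evariance_mul, ← ofReal_variance hsumLp, hsum]
  gcongr
  rw [ENNReal.ofReal_sum_of_nonneg fun i _ => variance_nonneg _ _]
  refine Finset.sum_le_sum fun i _ => ?_
  exact (ENNReal.ofReal_le_ofReal (hvar i)).trans
    (ofReal_integral_norm_eq_lintegral_enorm ((hint i).sub (integrable_const c))).le

lemma enorm_sub_sq_le (u v h : ℝ) : ‖u - v‖ₑ ^ 2 ≤ 2 * (‖u - h‖ₑ ^ 2 + ‖v - h‖ₑ ^ 2) := by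
  have e : ∀ x : ℝ, ‖x‖ₑ ^ 2 = ENNReal.ofReal (x ^ 2) := fun x => by
    rw [← enorm_pow, Real.enorm_of_nonneg (sq_nonneg x)]
  rw [e, e, e, ← ENNReal.ofReal_add (sq_nonneg _) (sq_nonneg _),
    ← ENNReal.ofReal_ofNat 2, ← ENNReal.ofReal_mul (by norm_num)]
  refine ENNReal.ofReal_le_ofReal ?_
  nlinarith [sq_nonneg (u - h + (v - h))]

lemma MonotoneOn.aemeasurable_of_ae_mem {F₀ : Measure ℝ} {s : Set ℝ} (hs : MeasurableSet s)
    (hF₀ : ∀ᵐ x ∂F₀, x ∈ s) {m₀ : ℝ → ℝ} (hm₀ : MonotoneOn m₀ s) : AEMeasurable m₀ F₀ := by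
  have := aemeasurable_restrict_of_monotoneOn (μ := F₀) hs hm₀
  rwa [Measure.restrict_eq_self_of_ae_mem hF₀] at this

lemma measurable_indicator_sub_cdf (ν : Measure ℝ) :
    Measurable fun p : ℝ × ℝ × ℝ =>
      (Ici p.1).indicator (fun _ => (1 : ℝ)) p.2.2 - cdf ν (p.2.2 - p.2.1) := by
  have h : (fun p : ℝ × ℝ × ℝ => (Ici p.1).indicator (fun _ => (1 : ℝ)) p.2.2)
      = {p : ℝ × ℝ × ℝ | p.1 ≤ p.2.2}.indicator fun _ => (1 : ℝ) := by
    ext p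
    simp only [indicator, mem_Ici, mem_ofPred_eq]
  refine Measurable.sub (h ▸ measurable_const.indicator
    (measurableSet_le (by fun_prop) (by fun_prop))) ((monotone_cdf ν).measurable.comp (by fun_prop))

lemma aemeasurable_empiricalCDF_sub_smoothedCDF {Ω : Type*} [MeasurableSpace Ω] {P : Measure Ω}
    (μ : Measure ℝ) (ν : Measure ℝ) [SFinite P] {A B : ℕ → Ω → ℝ}
    (hA : ∀ i, AEMeasurable (A i) P) (hB : ∀ i, AEMeasurable (B i) P) (n : ℕ) :
    AEMeasurable (fun p : Ω × ℝ => empiricalCDF n (fun i => A i p.1) p.2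
      - smoothedCDF (cdf ν) n (fun i => B i p.1) p.2) (P.prod μ) := by
  simp_rw [empiricalCDF_sub_smoothedCDF]
  refine (Finset.aemeasurable_fun_sum _ fun i _ => ?_).const_mul _
  exact (measurable_indicator_sub_cdf ν).comp_aemeasurable
    ((hA i).comp_fst.prodMk ((hB i).comp_fst.prodMk measurable_snd.aemeasurable))

section Model

variable {Ω : Type*} [MeasurableSpace Ω] {P : Measure Ω}
  {F₀ : Measure ℝ} [IsProbabilityMeasure F₀] {ν : Measure ℝ} [IsProbabilityMeasure ν]
  {m₀ : ℝ → ℝ}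

/-- The smoothed variables `Φ(z - m₀(X))` have mean `H(z)`, `H` the distribution function of `Y`. -/
lemma integral_cdf_sub_eq (hm₀ : AEMeasurable m₀ F₀) {X : Ω → ℝ} (hX : HasLaw X F₀ P) (z : ℝ) :
    ∫ ω, cdf ν (z - m₀ (X ω)) ∂P
      = ∫ u, (Iic z).indicator (fun _ => (1 : ℝ)) u ∂((F₀.map m₀).conv ν) := by
  have hp : IsProbabilityMeasure (F₀.map m₀) := Measure.isProbabilityMeasure_map hm₀
  have hmz : Measurable fun x => cdf ν (z - x) :=
    (monotone_cdf ν).measurable.comp (by fun_prop)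
  rw [integral_conv ((integrable_const 1).indicator measurableSet_Iic)]
  have h1 := hX.integral_comp (f := fun x => cdf ν (z - m₀ x))
    (hmz.comp_aemeasurable hm₀).aestronglyMeasurable
  refine h1.trans ?_
  rw [← integral_map (f := fun x => cdf ν (z - x)) hm₀ hmz.aestronglyMeasurable]
  refine integral_congr_ae (Eventually.of_forall fun x => ?_)
  have h2 : (fun e => (Iic z).indicator (fun _ => (1 : ℝ)) (x + e))
      = (Iic (z - x)).indicator fun _ => (1 : ℝ) := by
    ext e
    simp only [indicator, mem_Iic, le_sub_iff_add_le']
  simp only [h2]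
  rw [integral_indicator_const _ measurableSet_Iic, cdf_eq_real]
  simp

lemma integral_indicator_Ici_eq {μ : Measure ℝ} {Y : Ω → ℝ} (hY : HasLaw Y μ P) (z : ℝ) :
    ∫ ω, (Ici (Y ω)).indicator (fun _ => (1 : ℝ)) z ∂P
      = ∫ u, (Iic z).indicator (fun _ => (1 : ℝ)) u ∂μ :=
  hY.integral_comp (f := (Iic z).indicator fun _ => (1 : ℝ))
    (measurable_const.indicator measurableSet_Iic).aestronglyMeasurable

lemma lintegral_enorm_conv_le (hm₀ : AEMeasurable m₀ F₀) {K : ℝ} (hK : ∀ᵐ x ∂F₀, |m₀ x| ≤ K) :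
    ∫⁻ u, ‖u‖ₑ ∂((F₀.map m₀).conv ν) ≤ ENNReal.ofReal K + ∫⁻ e, ‖e‖ₑ ∂ν := by
  rw [Measure.lintegral_conv measurable_enorm, lintegral_map' (by fun_prop) hm₀]
  calc ∫⁻ x, (∫⁻ e, ‖m₀ x + e‖ₑ ∂ν) ∂F₀
      ≤ ∫⁻ _, (ENNReal.ofReal K + ∫⁻ e, ‖e‖ₑ ∂ν) ∂F₀ := by
        refine lintegral_mono_ae ?_
        filter_upwards [hK] with x hx
        calc ∫⁻ e, ‖m₀ x + e‖ₑ ∂ν ≤ ∫⁻ e, (‖m₀ x‖ₑ + ‖e‖ₑ) ∂ν :=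
              lintegral_mono fun e => enorm_add_le _ _
          _ = ‖m₀ x‖ₑ + ∫⁻ e, ‖e‖ₑ ∂ν := by
              rw [lintegral_add_left measurable_const]; simp
          _ ≤ _ := by
              gcongr
              rw [Real.enorm_eq_ofReal_abs]
              exact ENNReal.ofReal_le_ofReal hx
    _ = _ := by simp

/-- The empirical distribution function of the responses is within `O(1/n)` of the smoothed
distribution function of `m₀(X₁), …, m₀(Xₙ)`, in mean integrated squared error. -/
lemma lintegral_lintegral_empiricalCDF_sub_smoothedCDF_le [IsProbabilityMeasure P]
    (hm₀ : AEMeasurable m₀ F₀) {K : ℝ}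
    (hK : ∀ᵐ x ∂F₀, |m₀ x| ≤ K) {X Y : ℕ → Ω → ℝ}
    (hX_law : ∀ i, HasLaw (X i) F₀ P) (hX_indep : iIndepFun X P)
    (hY_law : ∀ i, HasLaw (Y i) ((F₀.map m₀).conv ν) P) (hY_indep : iIndepFun Y P)
    {n : ℕ} (hn : 0 < n) :
    ∫⁻ ω, (∫⁻ z, ‖empiricalCDF n (fun i => Y i ω) z
        - smoothedCDF (cdf ν) n (fun i => m₀ (X i ω)) z‖ₑ ^ 2) ∂P
      ≤ ENNReal.ofReal (4 / n) * (ENNReal.ofReal K + ∫⁻ e, ‖e‖ₑ ∂ν) := by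
  set M : ℝ≥0∞ := ENNReal.ofReal K + ∫⁻ e, ‖e‖ₑ ∂ν with hM
  have hmX : ∀ i, AEMeasurable (fun ω => m₀ (X i ω)) P := fun i =>
    ((hX_law i).map_eq ▸ hm₀).comp_aemeasurable (hX_law i).aemeasurable
  have hY : ∀ i, AEMeasurable (Y i) P := fun i => (hY_law i).aemeasurable
  have hcm : ∀ z, Measurable fun x => cdf ν (z - x) := fun z =>
    (monotone_cdf ν).measurable.comp (by fun_prop)
  have hjoint := aemeasurable_empiricalCDF_sub_smoothedCDF (P := P) volume ν hY hmX n
  rw [lintegral_lintegral_swap (hjoint.enorm.pow_const 2)]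
  -- The centring point depends on `z`: subtracting the Heaviside function removes the limit 1 at
  -- `+∞`, so that first absolute deviations are integrable in `z`.
  set c : ℝ → ℝ := (Ici (0 : ℝ)).indicator fun _ => (1 : ℝ) with hc
  have hc01 : ∀ z, c z ∈ Icc (0 : ℝ) 1 := fun z => by
    by_cases hz : 0 ≤ z <;> simp [hc, hz]
  set U : ℝ → ℕ → Ω → ℝ := fun z i ω => (Ici (Y i ω)).indicator (fun _ => (1 : ℝ)) z with hU
  set V : ℝ → ℕ → Ω → ℝ := fun z i ω => cdf ν (z - m₀ (X i ω)) with hV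
  have hUind : ∀ z, iIndepFun (U z) P := fun z =>
    hY_indep.comp (fun _ => (Iic z).indicator fun _ => (1 : ℝ))
      fun _ => measurable_const.indicator measurableSet_Iic
  have hUm : ∀ z i, AEMeasurable (U z i) P := fun z i =>
    (measurable_const.indicator measurableSet_Iic :
      Measurable ((Iic z).indicator fun _ => (1 : ℝ))).comp_aemeasurable (hY i)
  have hVm : ∀ z i, AEMeasurable (V z i) P := fun z i => (hcm z).comp_aemeasurable (hmX i)
  have hVind : ∀ z, iIndepFun (V z) P := fun z =>
    hX_indep.comp₀ (fun _ x => cdf ν (z - m₀ x)) (fun i => (hX_law i).aemeasurable)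
      fun i => (hcm z).comp_aemeasurable ((hX_law i).map_eq ▸ hm₀)
  have hU01 : ∀ z i ω, U z i ω ∈ Icc (0 : ℝ) 1 := fun z i ω => by
    by_cases hz : Y i ω ≤ z <;> simp [hU, hz]
  have hV01 : ∀ z i ω, V z i ω ∈ Icc (0 : ℝ) 1 := fun z i ω => ⟨cdf_nonneg _ _, cdf_le_one _ _⟩
  set q : ℝ≥0∞ := ENNReal.ofReal (((n : ℝ)⁻¹) ^ 2) with hq
  -- Both averages are compared with their common mean `H(z)`, which splits the error into two
  -- variances.
  have hUV : ∀ z, ∫⁻ ω, ‖empiricalCDF n (fun i => Y i ω) z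
        - smoothedCDF (cdf ν) n (fun i => m₀ (X i ω)) z‖ₑ ^ 2 ∂P
      ≤ 2 * (q * ∑ i ∈ Finset.range n, ∫⁻ ω, ‖U z i ω - c z‖ₑ ∂P
        + q * ∑ i ∈ Finset.range n, ∫⁻ ω, ‖V z i ω - c z‖ₑ ∂P) := fun z => by
    set h : ℝ := ∫ u, (Iic z).indicator (fun _ => (1 : ℝ)) u ∂((F₀.map m₀).conv ν)
    refine (lintegral_mono fun ω => enorm_sub_sq_le _ _ h).trans ?_
    rw [lintegral_const_mul' _ _ (by simp), lintegral_add_left']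
    · gcongr
      · exact (hUind z).lintegral_average_sub_sq_le (hUm z) (hU01 z)
          (fun i => integral_indicator_Ici_eq (hY_law i) z) (hc01 z) hn
      · exact (hVind z).lintegral_average_sub_sq_le (hVm z) (hV01 z)
          (fun i => integral_cdf_sub_eq hm₀ (hX_law i) z) (hc01 z) hn
    · exact ((((Finset.aemeasurable_fun_sum _ fun i _ => hUm z i).const_mul _).sub_const
        h).enorm.pow_const 2)
  have hUjoint : ∀ i, AEMeasurable (fun p : ℝ × Ω => ‖U p.1 i p.2 - c p.1‖ₑ) (volume.prod P) :=
    fun i => (measurable_stepDiff_uncurry.comp_aemeasurable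
      ((hY i).comp_snd.prodMk (aemeasurable_const.prodMk measurable_fst.aemeasurable))).enorm
  have hVjoint : ∀ i, AEMeasurable (fun p : ℝ × Ω => ‖V p.1 i p.2 - c p.1‖ₑ) (volume.prod P) :=
    fun i => by
      refine AEMeasurable.enorm (AEMeasurable.sub ?_ ?_)
      · exact (monotone_cdf ν).measurable.comp_aemeasurable
          (measurable_fst.aemeasurable.sub (hmX i).comp_snd)
      · exact ((measurable_const.indicator measurableSet_Ici).comp measurable_fst).aemeasurable
  have hUint : ∀ i, ∫⁻ z, (∫⁻ ω, ‖U z i ω - c z‖ₑ ∂P) ≤ M := fun i => by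
    rw [lintegral_lintegral_swap (hUjoint i)]
    have h1 : ∀ ω, ∫⁻ z, ‖U z i ω - c z‖ₑ = ‖Y i ω‖ₑ := fun ω => by
      have := lintegral_enorm_stepDiff (Y i ω) 0
      rwa [sub_zero] at this
    simp_rw [h1]
    rw [(hY_law i).lintegral_comp (f := fun y => ‖y‖ₑ) measurable_enorm.aemeasurable]
    exact lintegral_enorm_conv_le hm₀ hK
  have hVint : ∀ i, ∫⁻ z, (∫⁻ ω, ‖V z i ω - c z‖ₑ ∂P) ≤ M := fun i => by
    rw [lintegral_lintegral_swap (hVjoint i)]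
    have hKX : ∀ᵐ ω ∂P, |m₀ (X i ω)| ≤ K :=
      ae_of_ae_map (hX_law i).aemeasurable ((hX_law i).map_eq.symm ▸ hK)
    have h1 : ∀ᵐ ω ∂P, ∫⁻ z, ‖V z i ω - c z‖ₑ ≤ M := by
      filter_upwards [hKX] with ω hω
      simp_rw [← enorm_neg (V _ i ω - c _), neg_sub]
      refine (lintegral_enorm_indicator_sub_cdf_le ν 0 (m₀ (X i ω))).trans ?_
      rw [enorm_zero, zero_add, Real.enorm_eq_ofReal_abs]
      exact add_le_add_left (ENNReal.ofReal_le_ofReal hω) _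
    exact (lintegral_mono_ae h1).trans (by simp)
  have hsum : ∀ G : ℝ → ℕ → Ω → ℝ,
      (∀ i, AEMeasurable (fun p : ℝ × Ω => ‖G p.1 i p.2 - c p.1‖ₑ) (volume.prod P)) →
      (∀ i, ∫⁻ z, (∫⁻ ω, ‖G z i ω - c z‖ₑ ∂P) ≤ M) →
      ∫⁻ z, q * ∑ i ∈ Finset.range n, ∫⁻ ω, ‖G z i ω - c z‖ₑ ∂P ≤ q * (n * M) := by
    intro G hG1 hG2
    rw [lintegral_const_mul' _ _ ENNReal.ofReal_ne_top,
      lintegral_finsetSum' _ fun i _ => (hG1 i).lintegral_prod_right']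
    gcongr
    refine (Finset.sum_le_sum fun i _ => hG2 i).trans ?_
    simp
  refine (lintegral_mono hUV).trans ?_
  rw [lintegral_const_mul' _ _ (by simp), lintegral_add_left']
  · refine (mul_le_mul_right (add_le_add (hsum U hUjoint hUint) (hsum V hVjoint hVint)) 2).trans ?_
    have hn' : (0 : ℝ) < n := Nat.cast_pos.2 hn
    -- The factor `n⁻²` of the variance against `n` summands leaves `1/n`; the final 4 is 2 from
    -- splitting the square times 2 averages.
    have : q * (n * M) = ENNReal.ofReal (1 / n) * M := by
      rw [← mul_assoc, hq, ← ENNReal.ofReal_natCast, ← ENNReal.ofReal_mul (by positivity)]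
      congr 2
      field_simp
    rw [this, ← two_mul, ← mul_assoc, ← mul_assoc, ← ENNReal.ofReal_ofNat 2,
      ← ENNReal.ofReal_mul (by positivity), ← ENNReal.ofReal_mul (by positivity)]
    gcongr
    exact le_of_eq (by ring)
  · exact (Finset.aemeasurable_fun_sum _ fun i _ =>
      (hUjoint i).lintegral_prod_right').const_mul _

end Model

/-! ### Measurability of the loss and conclusion -/

lemma sqDiffL_zero (m m₀ : ℝ → ℝ) (x : ℕ → ℝ) (w : ℝ) : sqDiffL m m₀ 0 x w = 0 := by
  simp [sqDiffL, empiricalCDF]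

lemma measurable_indicator_Ici_uncurry :
    Measurable fun p : ℝ × ℝ => (Ici p.1).indicator (fun _ => (1 : ℝ)) p.2 := by
  have h : (fun p : ℝ × ℝ => (Ici p.1).indicator (fun _ => (1 : ℝ)) p.2)
      = {p : ℝ × ℝ | p.1 ≤ p.2}.indicator fun _ => (1 : ℝ) := by
    ext p
    simp only [indicator, mem_Ici, mem_ofPred_eq]
  exact h ▸ measurable_const.indicator (measurableSet_le measurable_fst measurable_snd)

lemma aemeasurable_empiricalCDF {Ω : Type*} [MeasurableSpace Ω] {P : Measure Ω} [SFinite P]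
    {n : ℕ} {A : ℕ → Ω → ℝ} (hA : ∀ i < n, AEMeasurable (A i) P) :
    AEMeasurable (fun p : Ω × ℝ => empiricalCDF n (fun i => A i p.1) p.2) (P.prod volume) :=
  (Finset.aemeasurable_fun_sum _ fun i hi => measurable_indicator_Ici_uncurry.comp_aemeasurable
    ((hA i (Finset.mem_range.1 hi)).comp_fst.prodMk measurable_snd.aemeasurable)).const_mul _


theorem proposition2
    {Ω : Type*} [MeasurableSpace Ω] (P : Measure Ω) [IsProbabilityMeasure P]
    -- law of the covariates, supported on `[0,1]`, and regression function
    (F₀ : Measure ℝ) [IsProbabilityMeasure F₀] (hF₀ : ∀ᵐ x ∂F₀, x ∈ Icc (0 : ℝ) 1)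
    (m₀ : ℝ → ℝ) (hm₀ : MonotoneOn m₀ (Icc 0 1))
    (hm₀_bdd : ∃ K₀ : ℝ, ∀ x ∈ Icc (0 : ℝ) 1, |m₀ x| ≤ K₀)
    -- law of the noise: centred, with an even, ordinary smooth density
    (ν : Measure ℝ) [IsProbabilityMeasure ν]
    (hν_int : Integrable (fun e : ℝ => e) ν) (hν_mean : ∫ e, e ∂ν = 0)
    (f : ℝ → ℝ) (hf : IsDensityOf f ν) (hf_even : ∀ x, f (-x) = f x)
    (β : ℝ) (hβ : 0 < β) (hf_smooth : OrdinarySmooth f β) (hf_min : EventuallyMinimalFourier f)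
    -- two independent i.i.d. samples; `Y` has the law of `m₀(X) + ε`, with `ε` independent of `X`
    (X Y : ℕ → Ω → ℝ)
    (hX_law : ∀ i, HasLaw (X i) F₀ P) (hX_indep : iIndepFun X P)
    (hY_law : ∀ i, HasLaw (Y i) ((F₀.map m₀).conv ν) P) (hY_indep : iIndepFun Y P)
    (hXY : IndepFun (fun ω i => X i ω) (fun ω i => Y i ω) P)
    -- any (measurable) choice of the minimum contrast estimators
    (mhat : ℕ → Ω → ℝ → ℝ)
    (hmhat : ∀ n, 0 < n → ∀ᵐ ω ∂P,
      IsMinContrast (cdf ν) n (fun i => X i ω) (fun i => Y i ω) (mhat n ω))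
    (hmhat_meas : ∀ n, ∀ i < n, AEMeasurable (fun ω => mhat n ω (X i ω)) P) :
    (∀ n ω, Integrable (fun w => sqDiffL (mhat n ω) m₀ n (fun i => X i ω) w)) ∧
    (∀ n, Integrable (fun ω => ∫ w, sqDiffL (mhat n ω) m₀ n (fun i => X i ω) w) P) ∧
    (fun n : ℕ => ∫ ω, (∫ w, sqDiffL (mhat n ω) m₀ n (fun i => X i ω) w) ∂P)
      =O[atTop] fun n : ℕ => (n : ℝ) ^ (-1 / (2 * β + 1)) := by
  have hm₀_meas : AEMeasurable m₀ F₀ := hm₀.aemeasurable_of_ae_mem measurableSet_Icc hF₀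
  have hmX : ∀ i, AEMeasurable (fun ω => m₀ (X i ω)) P := fun i =>
    ((hX_law i).map_eq ▸ hm₀_meas).comp_aemeasurable (hX_law i).aemeasurable
  have hY : ∀ i, AEMeasurable (Y i) P := fun i => (hY_law i).aemeasurable
  have hX01 : ∀ᵐ ω ∂P, ∀ i, X i ω ∈ Icc (0 : ℝ) 1 := ae_all_iff.2 fun i =>
    ae_of_ae_map (hX_law i).aemeasurable ((hX_law i).map_eq.symm ▸ hF₀)
  obtain ⟨K, hK⟩ := hm₀_bdd
  have hKF : ∀ᵐ x ∂F₀, |m₀ x| ≤ K := hF₀.mono hK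
  obtain ⟨C, T₁, hC, hT₁, hdec⟩ :=
    hf.exists_integral_empiricalCDF_sub_sq_le hf_smooth hf_min
  -- the loss and the stochastic bound
  set J : ℕ → Ω → ℝ := fun n ω => ∫ w, sqDiffL (mhat n ω) m₀ n (fun i => X i ω) w with hJ
  set Q : ℕ → Ω → ℝ := fun n ω => ∫ z, (empiricalCDF n (fun i => Y i ω) z
    - smoothedCDF (cdf ν) n (fun i => m₀ (X i ω)) z) ^ 2 with hQ
  have hJ0 : ∀ n ω, 0 ≤ J n ω := fun n ω => integral_nonneg fun w => sq_nonneg _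
  have hQ0 : ∀ n ω, 0 ≤ Q n ω := fun n ω => integral_nonneg fun w => sq_nonneg _
  have hJQ : ∀ n, 0 < n → ∀ T ≥ T₁, ∀ᵐ ω ∂P,
      J n ω ≤ C * (T ^ (2 * β) * (4 * Q n ω) + 1 / T) := fun n hn T hT => by
    filter_upwards [hmhat n hn, hX01] with ω h1 h2
    have hT0 : 0 < T := hT₁.trans_le hT
    refine (hdec T hT n (fun i => mhat n ω (X i ω)) fun i => m₀ (X i ω)).trans ?_
    have := h1.integral_smoothedCDF_sub_sq_le hf hν_int hm₀ hn fun i _ => h2 i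
    have hTp : 0 < T ^ (2 * β) := Real.rpow_pos_of_pos hT0 _
    gcongr
  have hJm : ∀ n, AEStronglyMeasurable (J n) P := fun n => by
    have h1 := aemeasurable_empiricalCDF (P := P) (hmhat_meas n)
    have h2 := aemeasurable_empiricalCDF (P := P) (n := n) fun i _ => hmX i
    exact ((h1.sub h2).pow_const 2).aestronglyMeasurable.integral_prod_right'
  have hQm : ∀ n, AEStronglyMeasurable (Q n) P := fun n =>
    ((aemeasurable_empiricalCDF_sub_smoothedCDF volume ν hY hmX
      n).pow_const 2).aestronglyMeasurable.integral_prod_right'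
  obtain ⟨M, hM0, hM⟩ : ∃ M : ℝ, 0 ≤ M ∧
      ENNReal.ofReal K + ∫⁻ e, ‖e‖ₑ ∂ν = ENNReal.ofReal M := by
    have hfin : ENNReal.ofReal K + ∫⁻ e, ‖e‖ₑ ∂ν ≠ ⊤ :=
      ENNReal.add_ne_top.2 ⟨ENNReal.ofReal_ne_top, hν_int.2.ne⟩
    exact ⟨_, ENNReal.toReal_nonneg, (ENNReal.ofReal_toReal hfin).symm⟩
  have hQl : ∀ n, 0 < n → ∫⁻ ω, ENNReal.ofReal (Q n ω) ∂P ≤ ENNReal.ofReal (4 / n * M) :=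
    fun n hn => by
      have h := lintegral_lintegral_empiricalCDF_sub_smoothedCDF_le hm₀_meas hKF hX_law hX_indep
        hY_law hY_indep hn
      rw [hM, ← ENNReal.ofReal_mul (by positivity)] at h
      refine le_trans (lintegral_mono fun ω => ?_) h
      simp only [hQ]
      rw [ofReal_integral_eq_lintegral_ofReal
        (integrable_empiricalCDF_sub_smoothedCDF_sq hν_int n _ _)
        (Eventually.of_forall fun _ => sq_nonneg _)]
      refine lintegral_mono fun z => le_of_eq ?_
      rw [← enorm_pow, Real.enorm_of_nonneg (sq_nonneg _)]
  have hQi : ∀ n, 0 < n → Integrable (Q n) P := fun n hn => by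
    refine ⟨hQm n, ?_⟩
    rw [hasFiniteIntegral_iff_ofReal (Eventually.of_forall (hQ0 n))]
    exact (hQl n hn).trans_lt ENNReal.ofReal_lt_top
  have hQE : ∀ n, 0 < n → ∫ ω, Q n ω ∂P ≤ 4 / n * M := fun n hn => by
    rw [integral_eq_lintegral_of_nonneg_ae (Eventually.of_forall (hQ0 n)) (hQm n)]
    exact ENNReal.toReal_le_of_le_ofReal (by positivity) (hQl n hn)
  have hbi : ∀ n, 0 < n → ∀ T : ℝ,
      Integrable (fun ω => C * (T ^ (2 * β) * (4 * Q n ω) + 1 / T)) P := fun n hn T =>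
    ((((hQi n hn).const_mul 4).const_mul _).add (integrable_const _)).const_mul C
  have hJi : ∀ n, Integrable (J n) P := fun n => by
    rcases Nat.eq_zero_or_pos n with rfl | hn
    · simp only [hJ, sqDiffL_zero, integral_zero]
      exact integrable_zero _ _ _
    -- Any admissible cut-off gives integrability for fixed `n`; only the rate requires tuning `T`.
    · refine (hbi n hn T₁).mono' (hJm n) ?_
      filter_upwards [hJQ n hn T₁ le_rfl] with ω hω
      rwa [Real.norm_of_nonneg (hJ0 n ω)]
  have hJE : ∀ n, 0 < n → ∀ T ≥ T₁,
      ∫ ω, J n ω ∂P ≤ C * (T ^ (2 * β) * (16 * M / n) + 1 / T) := fun n hn T hT => by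
    have hT0 : 0 < T := hT₁.trans_le hT
    refine (integral_mono_ae (hJi n) (hbi n hn T) (hJQ n hn T hT)).trans ?_
    rw [integral_const_mul, integral_add (((hQi n hn).const_mul 4).const_mul _)
      (integrable_const _), integral_const_mul, integral_const_mul]
    simp only [integral_const, probReal_univ, one_smul]
    have h1 : 4 * ∫ ω, Q n ω ∂P ≤ 16 * M / n := by
      calc 4 * ∫ ω, Q n ω ∂P ≤ 4 * (4 / n * M) := by gcongr; exact hQE n hn
        _ = 16 * M / n := by ring
    have hTp : 0 < T ^ (2 * β) := Real.rpow_pos_of_pos hT0 _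
    gcongr
  refine ⟨fun n ω => (integrable_empiricalCDF_sub n _ _).sq_of_abs_le_one
    (abs_empiricalCDF_sub_le_one n _ _), hJi, ?_⟩
  have hβ' : 0 < 2 * β + 1 := by positivity
  -- The balancing cut-off `T = n^(1/(2β+1))` tends to infinity, hence eventually exceeds `T₁`; both
  -- terms then equal constants times `n^(-1/(2β+1))`.
  have hTlim : Tendsto (fun n : ℕ => (n : ℝ) ^ (1 / (2 * β + 1))) atTop atTop :=
    (tendsto_rpow_atTop (by positivity)).comp tendsto_natCast_atTop_atTop
  refine IsBigO.of_bound (C * (16 * M + 1)) ?_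
  filter_upwards [hTlim.eventually_ge_atTop T₁, eventually_gt_atTop 0] with n hT hn
  have hn' : (0 : ℝ) < n := Nat.cast_pos.2 hn
  rw [Real.norm_of_nonneg (integral_nonneg (hJ0 n)),
    Real.norm_of_nonneg (Real.rpow_nonneg hn'.le _)]
  refine (hJE n hn _ hT).trans (le_of_eq ?_)
  have e1 : ((n : ℝ) ^ (1 / (2 * β + 1))) ^ (2 * β) * (16 * M / n)
      = 16 * M * (n : ℝ) ^ (-1 / (2 * β + 1)) := by
    rw [← Real.rpow_mul hn'.le]
    have : -1 / (2 * β + 1) = 1 / (2 * β + 1) * (2 * β) - 1 := by field_simp; ring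
    rw [this, Real.rpow_sub_one hn'.ne']
    ring
  have e2 : 1 / (n : ℝ) ^ (1 / (2 * β + 1)) = (n : ℝ) ^ (-1 / (2 * β + 1)) := by
    rw [neg_div, Real.rpow_neg hn'.le, one_div]
  rw [e1, e2]
  ring
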